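/- Let $k$ be a number field. For a point $p=[x_0:\dots:x_N]\in\mathbb{P}^N(k)$ let $ht(p)=\prod_v \max_i\|x_i\|_v$ be its multiplicative height relative to $k$, where $v$ runs over the places of $k$ and $\|\cdot\|_v$ are the normalized absolute values, with $\|x\|_v=|\sigma_v(x)|$ at real places, $\|x\|_v=|\sigma_v(x)|^2$ at complex places, and $\|x\|_{\mathfrak p}=N(\mathfrak p)^{-\operatorname{ord}_{\mathfrak p}(x)}$ at finite places. For $k=\mathbb{Q}$ and coprime integers $x_i$ this is $\max_i|x_i|$. For a hypersurface $X\subset\mathbb{P}^N$ over $k$ and $B\in\mathbb{N}$ put $X_B(k)=\{p\in X(k) : ht(p)\le B\}$. Let $X^{2n}=\{x_0^3+\dots+x_{2n+1}^3=0\}\subset\mathbb{P}^{2n+1}$ be the Fermat cubic, and for $t\in k$ let $$X_t^4=\{x_0^3+x_1^3+x_2^3+x_3^3+x_4^3+x_5^3+tA+t^2B'=0\}\subset\mathbb{P}^5,$$ where $$A=x_1x_4^2-x_0x_4x_5+3x_2x_4x_5+x_2x_5^2-2x_3x_5^2,$$ $$B'=x_0^2x_5-x_0x_2x_5+x_1x_2x_5+x_2^2x_5+x_0x_3x_5-x_2x_3x_5.$$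 All the sets $X_B(k)$ below are finite, and the following hold. 1. For every $n\ge 1$, the inequalities $$B^{\frac{2n+1}{4}}\le \# X^{2n}_B(k)\le B^{4n+2}$$ hold for all sufficiently large $B\in\mathbb{N}$ (depending on $k$ and $n$). 2. For all but finitely many $t\in k$, the inequalities $$B^{\frac54}\le \#(X^4_t)_B(k)\le B^{10}$$ hold for all sufficiently large $B\in\mathbb{N}$ (depending on $k$ and $t$). 3. For $n=1$ the lower bound can be improved: $\# X^2_B(k)\ge B$ for all sufficiently large $B\in\mathbb{N}$. -/

import Mathlib

open Filter MvPolynomial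

/-- The `k`-points of the hypersurface `{F = 0}` in the projective space with homogeneous
coordinates indexed by `Fin m`. For homogeneous `F` the condition does not depend on the
representative, see `mk_mem_hypersurfacePoints`. -/
def hypersurfacePoints {k : Type*} [Field k] {m : ℕ} (F : MvPolynomial (Fin m) k) :
    Set (Projectivization k (Fin m → k)) :=
  {p | eval p.rep F = 0}

theorem mk_mem_hypersurfacePoints {k : Type*} [Field k] {m d : ℕ} {F : MvPolynomial (Fin m) k}
    (hF : F.IsHomogeneous d) (v : Fin m → k) (hv : v ≠ 0) :
    Projectivization.mk k v hv ∈ hypersurfacePoints F ↔ eval v F = 0 := by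
  obtain ⟨a, ha⟩ := Projectivization.exists_smul_eq_mk_rep k v hv
  have h : eval (a • v) F = (a : k) ^ d * eval v F := by
    simp only [eval_eq, Finset.mul_sum]
    refine Finset.sum_congr rfl fun e he => ?_
    have hd : ∑ i ∈ e.support, e i = d := by
      have := hF (mem_support_iff.mp he)
      simpa [Finsupp.weight_apply, Finsupp.sum] using this
    simp only [Pi.smul_apply, Units.smul_def, smul_eq_mul, mul_pow, Finset.prod_mul_distrib,
      Finset.prod_pow_eq_pow_sum, hd]
    ring
  change eval (Projectivization.mk k v hv).rep F = 0 ↔ _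
  rw [← ha, h]
  simp

/-- The points of `{F = 0}` over the number field `k` of height at most `B`.

`Projectivization.mulHeight` is the multiplicative height relative to `k`: the product over all
places `v` of `k` of `max_i ‖x_i‖_v`, where `‖·‖_v` is the normalised absolute value (the square of
the usual modulus at complex places). For `k = ℚ` and coprime integer coordinates it is
`max_i |x_i|`. -/
def boundedHeightPoints {k : Type*} [Field k] [NumberField k] {m : ℕ}
    (F : MvPolynomial (Fin m) k) (B : ℕ) : Set (Projectivization k (Fin m → k)) :=
  {p | p ∈ hypersurfacePoints F ∧ p.mulHeight ≤ (B : ℝ)}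

/-- The form `x_0^3 + ... + x_{2n+1}^3` defining the Fermat cubic `X^{2n}` in `ℙ^{2n+1}`. -/
noncomputable def fermatCubic (k : Type*) [Field k] (n : ℕ) : MvPolynomial (Fin (2 * n + 2)) k :=
  ∑ i, X i ^ 3

noncomputable def cubicA (k : Type*) [Field k] : MvPolynomial (Fin 6) k :=
  X 1 * X 4 ^ 2 - X 0 * X 4 * X 5 + 3 * X 2 * X 4 * X 5 + X 2 * X 5 ^ 2 - 2 * X 3 * X 5 ^ 2

noncomputable def cubicB (k : Type*) [Field k] : MvPolynomial (Fin 6) k :=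
  X 0 ^ 2 * X 5 - X 0 * X 2 * X 5 + X 1 * X 2 * X 5 + X 2 ^ 2 * X 5 + X 0 * X 3 * X 5
    - X 2 * X 3 * X 5

/-- The form `x_0^3 + ... + x_5^3 + t A + t^2 B` defining the cubic fourfold `X_t^4` in `ℙ^5`. -/
noncomputable def cubicFamily {k : Type*} [Field k] (t : k) : MvPolynomial (Fin 6) k :=
  X 0 ^ 3 + X 1 ^ 3 + X 2 ^ 3 + X 3 ^ 3 + X 4 ^ 3 + X 5 ^ 3
    + C t * cubicA k + C t ^ 2 * cubicB k

theorem isHomogeneous_fermatCubic (k : Type*) [Field k] (n : ℕ) :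
    (fermatCubic k n).IsHomogeneous 3 :=
  IsHomogeneous.sum _ _ _ fun i _ => by simpa using (isHomogeneous_X k i).pow 3

theorem isHomogeneous_cubicFamily {k : Type*} [Field k] (t : k) :
    (cubicFamily t).IsHomogeneous 3 := by
  have x (i : Fin 6) : (X i : MvPolynomial (Fin 6) k).IsHomogeneous 1 := isHomogeneous_X k i
  have c2 : (2 : MvPolynomial (Fin 6) k).IsHomogeneous 0 := isHomogeneous_C _ (2 : k)
  have c3 : (3 : MvPolynomial (Fin 6) k).IsHomogeneous 0 := isHomogeneous_C _ (3 : k)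
  have ct : (C t : MvPolynomial (Fin 6) k).IsHomogeneous 0 := isHomogeneous_C _ t
  have cube (i : Fin 6) : (X i ^ 3 : MvPolynomial (Fin 6) k).IsHomogeneous 3 := (x i).pow 3
  have hA : (cubicA k).IsHomogeneous 3 :=
    ((((((x 1).mul ((x 4).pow 2)).sub (((x 0).mul (x 4)).mul (x 5))).add
      (((c3.mul (x 2)).mul (x 4)).mul (x 5))).add ((x 2).mul ((x 5).pow 2))).sub
      ((c2.mul (x 3)).mul ((x 5).pow 2)))
  have hB : (cubicB k).IsHomogeneous 3 :=
    (((((((x 0).pow 2).mul (x 5)).sub (((x 0).mul (x 2)).mul (x 5))).add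
      (((x 1).mul (x 2)).mul (x 5))).add (((x 2).pow 2).mul (x 5))).add
      (((x 0).mul (x 3)).mul (x 5))).sub (((x 2).mul (x 3)).mul (x 5))
  have hA' : (C t * cubicA k).IsHomogeneous 3 := by simpa using ct.mul hA
  have hB' : (C t ^ 2 * cubicB k).IsHomogeneous 3 := by simpa using (ct.pow 2).mul hB
  exact (((((((cube 0).add (cube 1)).add (cube 2)).add (cube 3)).add (cube 4)).add (cube 5)).add
    hA').add hB'

/-!
Write `K` for the number field and `𝓞` for its ring of integers. All members of the family `X_t`
contain the Fermat cubic surface `x_4 = x_5 = 0`, and a Fermat cubic contains the linear subspace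
`x_i + x_{n + 1 + i} = 0` of dimension `n`. The lower bounds are therefore lower bounds for the
number of points of bounded height of `ℙ ^ n`, and the upper bounds, which are far from sharp, hold
already for the ambient projective space. Both are weak forms of Schanuel's theorem.

*Lower bound.* A point `[1 : x]` of `ℙ ^ n` with bounded conjugates has height of the order of the
norm of the denominator ideal of `x`, which is the annihilator of the class of `x` in
`(K / 𝓞) ^ n`. The pairs `(I, x)` of an ideal `I` of norm at most `m` and a class `x` killed by `I`
number `∑ N(I) ^ n`, since the `I`-torsion of `K / 𝓞` has `N(I)` elements
(`card_torsion_modIntegers`). Ideals of norm at most `m` number asymptotically `κ m` with `κ > 0`,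
so this sum has order `m ^ (n + 1)`. A class with annihilator `D` occurs in `O(m / N(D))` pairs, and
the classes with `N(D) ≤ ε m` account for a small proportion of all pairs, so that at least of order
`m ^ (n + 1)` classes remain (`exists_le_ncard_torsionLE`). Class representatives of bounded
conjugates turn them into distinct points of height `O(m)` (`exists_integral_points`).

*Upper bound.* As the class group is finite, every point has an integral representative `y` for
which the height is the product of `max_i ‖y_i‖_v` over the infinite places, up to a constant
(`exists_integral_representative`). Choose `i` with `y_i ≠ 0`. The ideal `(y_i)` and the sizes
`max_j |y_j / y_i|_v` up to a factor of `2` take few values, and, these being given, the quotients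
`y_j / y_i` are elements of `a⁻¹ 𝓞`, with `(a) = (y_i)`, in a box of known volume. Such a box,
though it may be unbalanced, has no more elements than expected, because nonzero elements of
`a⁻¹ 𝓞` have norm at least `1 / |N(a)|` (`finite_integralBox_and_ncard_le`). This bounds the number
of points of `ℙ ^ (m - 1)` by `B ^ (m + 1)` times a power of `log B`.
-/

namespace NumberField

variable (K : Type*) [Field K] [NumberField K]

open scoped nonZeroDivisors

/-! ### Counting ideals of bounded norm -/

open Classical in
/-- The nonzero ideals of `𝓞 K` of norm at most `m`. -/
noncomputable def idealsLE (m : ℕ) : Finset (Ideal (𝓞 K)) :=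
  (Ideal.finite_setOfPred_absNorm_le (S := 𝓞 K) m).toFinset.filter (· ≠ ⊥)

variable {K} in
lemma mem_idealsLE {m : ℕ} {I : Ideal (𝓞 K)} :
    I ∈ idealsLE K m ↔ Ideal.absNorm I ≤ m ∧ I ≠ ⊥ := by
  simp [idealsLE]

variable {K} in
lemma absNorm_pos {I : Ideal (𝓞 K)} (hI : I ≠ ⊥) : 0 < Ideal.absNorm I :=
  Nat.pos_of_ne_zero (mt Ideal.absNorm_eq_zero_iff.mp hI)

lemma card_idealsLE (m : ℕ) : (idealsLE K m).card =
    Nat.card {I : (Ideal (𝓞 K))⁰ // (Ideal.absNorm (I : Ideal (𝓞 K)) : ℝ) ≤ m} := by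
  rw [← Fintype.card_coe, ← Nat.card_eq_fintype_card]
  exact Nat.card_congr
    { toFun := fun I ↦ ⟨⟨I.1, mem_nonZeroDivisors_of_ne_zero (mem_idealsLE.mp I.2).2⟩,
        by exact_mod_cast (mem_idealsLE.mp I.2).1⟩
      invFun := fun I ↦ ⟨I.1.1, mem_idealsLE.mpr
        ⟨by exact_mod_cast I.2, nonZeroDivisors.coe_ne_zero I.1⟩⟩
      left_inv := fun _ ↦ rfl
      right_inv := fun _ ↦ rfl }

lemma exists_tendsto_card_idealsLE :
    ∃ κ : ℝ, 0 < κ ∧ Tendsto (fun m : ℕ ↦ ((idealsLE K m).card : ℝ) / m) atTop (nhds κ) := by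
  refine ⟨_, ?_, ((Ideal.tendsto_norm_le_div_atTop₀ K).comp tendsto_natCast_atTop_atTop).congr
    fun m ↦ ?_⟩
  · have := Units.regulator_pos K
    have := classNumber_pos K
    have := Units.torsionOrder_pos K
    have : 0 < |(discr K : ℝ)| := by simpa using discr_ne_zero K
    positivity
  · simp [card_idealsLE]

lemma exists_card_idealsLE_le : ∃ C : ℝ, 0 < C ∧ ∀ m : ℕ, ((idealsLE K m).card : ℝ) ≤ C * m := by
  obtain ⟨κ, -, h⟩ := exists_tendsto_card_idealsLE K
  obtain ⟨C, hC⟩ := h.bddAbove_range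
  refine ⟨max C 1, by positivity, fun m ↦ ?_⟩
  rcases Nat.eq_zero_or_pos m with rfl | hm
  · have : idealsLE K 0 = ∅ := by
      ext I
      simp only [mem_idealsLE, Finset.notMem_empty, iff_false, not_and, not_not]
      exact fun h ↦ Ideal.absNorm_eq_zero_iff.mp (by lia)
    simp [this]
  · have hm' : (0 : ℝ) < m := by exact_mod_cast hm
    rw [← div_le_iff₀ hm']
    exact (hC ⟨m, rfl⟩).trans (le_max_left _ _)

/-! ### Representing ideal classes by ideals of bounded norm -/

/-- Every ideal class has an integral representative of norm at most a constant. -/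
lemma exists_class_representatives : ∃ C : ℕ, ∃ rep : ClassGroup (𝓞 K) → (Ideal (𝓞 K))⁰,
    ∀ c, ClassGroup.mk0 (rep c) = c ∧ Ideal.absNorm (rep c : Ideal (𝓞 K)) ≤ C := by
  choose rep hrep using ClassGroup.mk0_surjective (R := 𝓞 K)
  exact ⟨∑ c, Ideal.absNorm (rep c : Ideal (𝓞 K)), rep, fun c ↦ ⟨hrep c,
    Finset.single_le_sum (f := fun c ↦ Ideal.absNorm (rep c : Ideal (𝓞 K)))
      (fun _ _ ↦ Nat.zero_le _) (Finset.mem_univ c)⟩⟩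

lemma exists_mul_eq_span_singleton : ∃ C : ℕ, ∀ I : Ideal (𝓞 K), I ≠ ⊥ →
    ∃ (J : Ideal (𝓞 K)) (a : 𝓞 K), a ≠ 0 ∧ J ≠ ⊥ ∧ I * J = Ideal.span {a} ∧
      Ideal.absNorm J ≤ C := by
  obtain ⟨C, rep, h⟩ := exists_class_representatives K
  refine ⟨C, fun I hI ↦ ?_⟩
  let I' : (Ideal (𝓞 K))⁰ := ⟨I, mem_nonZeroDivisors_of_ne_zero hI⟩
  set J := rep (ClassGroup.mk0 I')⁻¹
  have hJ : (J : Ideal (𝓞 K)) ≠ ⊥ := nonZeroDivisors.coe_ne_zero J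
  have h1 : ClassGroup.mk0 (I' * J) = 1 := by rw [map_mul, (h _).1, mul_inv_cancel]
  rw [ClassGroup.mk0_eq_one_iff] at h1
  obtain ⟨a, ha⟩ := h1
  have ha' : I * J = Ideal.span {a} := ha
  refine ⟨J, a, ?_, hJ, ha', (h _).2⟩
  rintro rfl
  simp [hI, hJ] at ha'

lemma exists_span_singleton_mul_eq : ∃ C : ℕ, ∀ I : Ideal (𝓞 K), I ≠ ⊥ →
    ∃ (J : Ideal (𝓞 K)) (a b : 𝓞 K), a ≠ 0 ∧ b ≠ 0 ∧
      Ideal.span {a} * I = Ideal.span {b} * J ∧ Ideal.absNorm J ≤ C := by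
  obtain ⟨C, rep, h⟩ := exists_class_representatives K
  refine ⟨C, fun I hI ↦ ?_⟩
  let I' : (Ideal (𝓞 K))⁰ := ⟨I, mem_nonZeroDivisors_of_ne_zero hI⟩
  obtain ⟨a, b, ha, hb, hab⟩ := ClassGroup.mk0_eq_mk0_iff.mp (h (ClassGroup.mk0 I')).1.symm
  exact ⟨_, a, b, ha, hb, hab, (h _).2⟩

/-! ### Torsion of `K / 𝓞 K` -/

/-- The `𝓞 K`-module `K / 𝓞 K`. -/
abbrev ModIntegers : Type _ := K ⧸ LinearMap.range (Algebra.linearMap (𝓞 K) K)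

variable {K}

lemma mk_modIntegers_eq_zero {K : Type*} [Field K] {x : K} :
    (Submodule.Quotient.mk x : ModIntegers K) = 0 ↔ ∃ y : 𝓞 K, (y : K) = x := by
  rw [Submodule.Quotient.mk_eq_zero]
  rfl

lemma smul_mk_modIntegers_eq_zero {K : Type*} [Field K] {a : 𝓞 K} {x : K} :
    a • (Submodule.Quotient.mk x : ModIntegers K) = 0 ↔ ∃ y : 𝓞 K, (y : K) = a * x := by
  rw [← Submodule.Quotient.mk_smul, mk_modIntegers_eq_zero, Algebra.smul_def]

/-- The `I`-torsion of `K / 𝓞 K` has as many elements as `𝓞 K / I`: if `I * J = (a)`, then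
division by `a` identifies it with `J / (a)`. -/
lemma card_torsion_modIntegers {I : Ideal (𝓞 K)} (hI : I ≠ ⊥) :
    Nat.card {x : ModIntegers K // ∀ a ∈ I, a • x = 0} = Ideal.absNorm I := by
  obtain ⟨C, hC⟩ := exists_mul_eq_span_singleton K
  obtain ⟨J, a, ha, hJ, hIJ, -⟩ := hC I hI
  have haK : (a : K) ≠ 0 := by simpa using ha
  let f : J.toAddSubgroup →+ ModIntegers K :=
    { toFun := fun x ↦ Submodule.Quotient.mk ((x : 𝓞 K) / (a : K) : K)
      map_zero' := by simp
      map_add' := fun x y ↦ by simp [add_div] }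
  have haI : a ∈ I := (show I * J ≤ I from Ideal.mul_le_left)
    (hIJ ▸ Ideal.mem_span_singleton_self a)
  have hrange : Nat.card {x : ModIntegers K // ∀ a ∈ I, a • x = 0} = Nat.card f.range := by
    refine Nat.card_congr (Equiv.subtypeEquivRight fun q ↦ ?_)
    obtain ⟨x, rfl⟩ := Submodule.Quotient.mk_surjective _ q
    constructor
    · intro h
      obtain ⟨z, hz⟩ := smul_mk_modIntegers_eq_zero.mp (h a haI)
      have hle : I * Ideal.span {z} ≤ I * J := by
        rw [hIJ, Ideal.mul_le]
        intro b hb c hc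
        obtain ⟨c, rfl⟩ := Ideal.mem_span_singleton'.mp hc
        obtain ⟨w, hw⟩ := smul_mk_modIntegers_eq_zero.mp (h b hb)
        refine Ideal.mem_span_singleton'.mpr ⟨c * w,
          FaithfulSMul.algebraMap_injective (𝓞 K) K ?_⟩
        simp only [map_mul]
        rw [show algebraMap (𝓞 K) K z = _ from hz, show algebraMap (𝓞 K) K w = _ from hw]
        ring
      have hz' : z ∈ J := by
        have := Ideal.le_of_dvd ((mul_dvd_mul_iff_left hI).mp (Ideal.dvd_iff_le.mpr hle))
        exact this (Ideal.mem_span_singleton_self z)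
      refine ⟨⟨z, hz'⟩, ?_⟩
      change (Submodule.Quotient.mk ((z : 𝓞 K) / (a : K) : K) : ModIntegers K) = _
      rw [hz, mul_div_cancel_left₀ _ haK]
    · rintro ⟨⟨z, hz⟩, hzx⟩ b hb
      have : b * z ∈ Ideal.span {a} := hIJ ▸ Ideal.mul_mem_mul hb hz
      obtain ⟨w, hw⟩ := Ideal.mem_span_singleton'.mp this
      rw [← hzx]
      refine smul_mk_modIntegers_eq_zero.mpr ⟨w, ?_⟩
      rw [mul_div_assoc', eq_div_iff haK]
      exact_mod_cast congrArg (algebraMap (𝓞 K) K) hw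
  have hker : f.ker = (Ideal.span {a}).toAddSubgroup.addSubgroupOf J.toAddSubgroup := by
    ext ⟨x, hx⟩
    rw [AddMonoidHom.mem_ker, AddSubgroup.mem_addSubgroupOf]
    change (Submodule.Quotient.mk ((x : 𝓞 K) / (a : K) : K) : ModIntegers K) = 0 ↔
      x ∈ Ideal.span {a}
    rw [mk_modIntegers_eq_zero, Ideal.mem_span_singleton']
    refine exists_congr fun y ↦ ?_
    rw [eq_div_iff haK]
    exact_mod_cast Iff.rfl
  rw [hrange, ← AddSubgroup.index_ker, hker]
  change (Ideal.span {a}).toAddSubgroup.relIndex J.toAddSubgroup = _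
  have h1 : Ideal.span {a} ≤ J := hIJ ▸ Ideal.mul_le_right
  have h2 := AddSubgroup.relIndex_mul_index (H := (Ideal.span {a}).toAddSubgroup)
    (K := J.toAddSubgroup) (Submodule.toAddSubgroup_mono h1)
  rw [← Ideal.absNorm_eq_index, ← Ideal.absNorm_eq_index, ← hIJ, map_mul] at h2
  rw [hIJ] at h2
  exact Nat.eq_of_mul_eq_mul_right (absNorm_pos hJ) h2

lemma card_torsion_pi_modIntegers (n : ℕ) {I : Ideal (𝓞 K)} (hI : I ≠ ⊥) :
    Nat.card {x : Fin n → ModIntegers K // I ≤ Ideal.torsionOf (𝓞 K) _ x} =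
      Ideal.absNorm I ^ n := by
  rw [← card_torsion_modIntegers hI]
  have e : {x : Fin n → ModIntegers K // I ≤ Ideal.torsionOf (𝓞 K) _ x} ≃
      (Fin n → {x : ModIntegers K // ∀ a ∈ I, a • x = 0}) :=
    { toFun := fun x i ↦ ⟨x.1 i, fun a ha ↦ congrFun ((Ideal.mem_torsionOf_iff _ _).mp (x.2 ha)) i⟩
      invFun := fun x ↦ ⟨fun i ↦ (x i).1, fun a ha ↦ (Ideal.mem_torsionOf_iff _ _).mpr
        (funext fun i ↦ (x i).2 a ha)⟩
      left_inv := fun _ ↦ rfl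
      right_inv := fun _ ↦ rfl }
  rw [Nat.card_congr e, Nat.card_fun, Nat.card_fin]

/-! ### Counting torsion points of `(K / 𝓞 K)ⁿ` by the norm of their annihilator -/

variable (K) in
/-- The torsion points of `(K / 𝓞 K)ⁿ` whose annihilator has norm at most `m`. -/
def torsionLE (n m : ℕ) : Set (Fin n → ModIntegers K) :=
  {x | Ideal.torsionOf (𝓞 K) _ x ∈ idealsLE K m}

lemma mem_torsionLE_of_le {n m : ℕ} {I : Ideal (𝓞 K)} (hI : I ∈ idealsLE K m)
    {x : Fin n → ModIntegers K} (h : I ≤ Ideal.torsionOf (𝓞 K) _ x) : x ∈ torsionLE K n m := by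
  obtain ⟨h1, h2⟩ := mem_idealsLE.mp hI
  have h3 : Ideal.torsionOf (𝓞 K) _ x ≠ ⊥ := fun h0 ↦ h2 (le_bot_iff.mp (h0 ▸ h))
  exact mem_idealsLE.mpr ⟨(Nat.le_of_dvd (absNorm_pos h2)
    (Ideal.absNorm_dvd_absNorm_of_le h)).trans h1, h3⟩

lemma finite_torsionLE (n m : ℕ) : (torsionLE K n m).Finite := by
  refine ((idealsLE K m).finite_toSet.biUnion (t := fun I ↦
    {x : Fin n → ModIntegers K | I ≤ Ideal.torsionOf (𝓞 K) _ x}) fun I hI ↦ ?_).subset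
    fun x hx ↦ Set.mem_biUnion (show _ ∈ _ from hx) (le_refl (Ideal.torsionOf (𝓞 K) _ x))
  have hI' := (mem_idealsLE.mp hI).2
  refine Set.finite_coe_iff.mp (Nat.finite_of_card_ne_zero ?_)
  have := card_torsion_pi_modIntegers n hI'
  exact this ▸ (pow_pos (absNorm_pos hI') n).ne'

open Classical in
lemma card_filter_le_torsionOf (n m : ℕ) {I : Ideal (𝓞 K)} (hI : I ∈ idealsLE K m) :
    ((finite_torsionLE (K := K) n m).toFinset.filter
      (I ≤ Ideal.torsionOf (𝓞 K) _ ·)).card = Ideal.absNorm I ^ n := by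
  rw [← card_torsion_pi_modIntegers n (mem_idealsLE.mp hI).2, ← Fintype.card_coe,
    ← Nat.card_eq_fintype_card]
  refine Nat.card_congr (Equiv.subtypeEquivRight fun x ↦ ?_)
  simp only [Finset.mem_filter, Set.Finite.mem_toFinset, and_iff_right_iff_imp]
  exact mem_torsionLE_of_le hI

open Classical in
/-- The ideals below a nonzero ideal `J` are the multiples of `J`. -/
lemma card_filter_le {C : ℝ} (hC : ∀ m : ℕ, ((idealsLE K m).card : ℝ) ≤ C * m) (hC0 : 0 < C)
    (m : ℕ) {J : Ideal (𝓞 K)} (hJ : J ≠ ⊥) :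
    (((idealsLE K m).filter (· ≤ J)).card : ℝ) ≤ C * m / Ideal.absNorm J := by
  have hJ0 := absNorm_pos hJ
  have hsub : (idealsLE K m).filter (· ≤ J) ⊆
      (idealsLE K (m / Ideal.absNorm J)).image (J * ·) := by
    intro I hI
    obtain ⟨hI, hIJ⟩ := Finset.mem_filter.mp hI
    obtain ⟨h1, h2⟩ := mem_idealsLE.mp hI
    obtain ⟨L, rfl⟩ := Ideal.dvd_iff_le.mpr hIJ
    refine Finset.mem_image.mpr ⟨L, mem_idealsLE.mpr ⟨?_, ?_⟩, rfl⟩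
    · rw [Nat.le_div_iff_mul_le hJ0, mul_comm, ← map_mul]
      exact h1
    · rintro rfl
      simp at h2
  calc _ ≤ ((idealsLE K (m / Ideal.absNorm J)).card : ℝ) := by
        exact_mod_cast (Finset.card_le_card hsub).trans Finset.card_image_le
    _ ≤ C * (m / Ideal.absNorm J : ℕ) := hC _
    _ ≤ C * (m / Ideal.absNorm J) := by gcongr; exact Nat.cast_div_le
    _ = _ := by ring

/-- Ideals of norm comparable to `m` alone make the sum of the `n`-th powers of the norms
of order `m ^ (n + 1)`. -/
lemma exists_le_sum_absNorm_pow (n : ℕ) : ∃ c : ℝ, 0 < c ∧ ∀ᶠ m : ℕ in atTop,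
    c * (m : ℝ) ^ (n + 1) ≤ ∑ I ∈ idealsLE K m, (Ideal.absNorm I : ℝ) ^ n := by
  classical
  obtain ⟨C, hC0, hC⟩ := exists_card_idealsLE_le K
  obtain ⟨κ, hκ, h⟩ := exists_tendsto_card_idealsLE K
  set δ : ℝ := κ / (4 * C) with hδ
  have hδ0 : 0 < δ := by positivity
  refine ⟨κ / 4 * δ ^ n, by positivity, ?_⟩
  filter_upwards [h.eventually_const_lt (half_lt_self hκ), eventually_gt_atTop 0] with m hm hm0
  have hm0' : (0 : ℝ) < m := by exact_mod_cast hm0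
  rw [lt_div_iff₀ hm0'] at hm
  have hsub : idealsLE K m \ idealsLE K ⌊δ * m⌋₊ ⊆ idealsLE K m := Finset.sdiff_subset
  have hcard : κ / 4 * m ≤ ((idealsLE K m \ idealsLE K ⌊δ * m⌋₊).card : ℝ) := by
    have h1 := Finset.le_card_sdiff (idealsLE K ⌊δ * m⌋₊) (idealsLE K m)
    have h2 : ((idealsLE K m).card : ℝ) ≤
        (idealsLE K m \ idealsLE K ⌊δ * m⌋₊).card + (idealsLE K ⌊δ * m⌋₊).card := by
      exact_mod_cast (by lia)
    have h3 : ((idealsLE K ⌊δ * m⌋₊).card : ℝ) ≤ C * (δ * m) :=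
      (hC _).trans (by gcongr; exact Nat.floor_le (by positivity))
    have h4 : C * (δ * m) = κ / 4 * m := by rw [hδ]; field_simp
    linarith
  calc κ / 4 * δ ^ n * (m : ℝ) ^ (n + 1) = κ / 4 * m * (δ * m) ^ n := by ring
    _ ≤ (idealsLE K m \ idealsLE K ⌊δ * m⌋₊).card * (δ * m) ^ n := by gcongr
    _ ≤ ∑ I ∈ idealsLE K m \ idealsLE K ⌊δ * m⌋₊, (Ideal.absNorm I : ℝ) ^ n := by
        rw [← nsmul_eq_mul]
        refine Finset.card_nsmul_le_sum _ _ _ fun I hI ↦ ?_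
        obtain ⟨h1, h2⟩ := Finset.mem_sdiff.mp hI
        have h3 : ⌊δ * m⌋₊ < Ideal.absNorm I := by
          by_contra! h3
          exact h2 (mem_idealsLE.mpr ⟨h3, (mem_idealsLE.mp h1).2⟩)
        gcongr
        exact (Nat.lt_of_floor_lt h3).le
    _ ≤ _ := Finset.sum_le_sum_of_subset_of_nonneg hsub fun _ _ _ ↦ by positivity

open Classical in
/-- The part of the double count carried by points with small annihilators. -/
lemma sum_torsionLE_div_le {C : ℝ} (hC : ∀ m : ℕ, ((idealsLE K m).card : ℝ) ≤ C * m)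
    (n m Y : ℕ) (hYm : Y ≤ m) :
    ∑ x ∈ (finite_torsionLE (K := K) (n + 1) m).toFinset.filter
        (fun x ↦ Ideal.absNorm (Ideal.torsionOf (𝓞 K) _ x) ≤ Y),
      (1 : ℝ) / Ideal.absNorm (Ideal.torsionOf (𝓞 K) _ x) ≤ C * (Y : ℝ) ^ (n + 1) := by
  rw [← Finset.sum_fiberwise_of_maps_to (g := fun x ↦ Ideal.torsionOf (𝓞 K) _ x)
    (t := idealsLE K Y) fun x hx ↦ ?_]
  · calc _ ≤ ∑ J ∈ idealsLE K Y, (Y : ℝ) ^ n := by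
          refine Finset.sum_le_sum fun J hJ ↦ ?_
          have hJ' := mem_idealsLE.mp hJ
          have hJ0 : (0 : ℝ) < Ideal.absNorm J := by exact_mod_cast absNorm_pos hJ'.2
          have hJm : J ∈ idealsLE K m := mem_idealsLE.mpr ⟨hJ'.1.trans hYm, hJ'.2⟩
          rw [Finset.sum_congr rfl (g := fun _ ↦ (1 : ℝ) / Ideal.absNorm J) fun x hx ↦ by
            rw [(Finset.mem_filter.mp hx).2], Finset.sum_const, nsmul_eq_mul]
          have hcard : ((Finset.filter (fun x ↦ Ideal.torsionOf (𝓞 K) _ x = J)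
              ((finite_torsionLE (K := K) (n + 1) m).toFinset.filter
                (fun x ↦ Ideal.absNorm (Ideal.torsionOf (𝓞 K) _ x) ≤ Y))).card : ℝ) ≤
              (Ideal.absNorm J : ℝ) ^ (n + 1) := by
            have := card_filter_le_torsionOf (n + 1) m hJm
            rw [← Nat.cast_pow, ← this, Nat.cast_le]
            refine Finset.card_le_card fun x hx ↦ ?_
            simp only [Finset.mem_filter] at hx ⊢
            exact ⟨hx.1.1, hx.2.ge⟩
          calc _ ≤ (Ideal.absNorm J : ℝ) ^ (n + 1) * (1 / Ideal.absNorm J) := by gcongr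
            _ = (Ideal.absNorm J : ℝ) ^ n := by field_simp; ring
            _ ≤ _ := by gcongr; exact_mod_cast hJ'.1
    _ = (idealsLE K Y).card * (Y : ℝ) ^ n := by rw [Finset.sum_const, nsmul_eq_mul]
    _ ≤ C * Y * (Y : ℝ) ^ n := by gcongr; exact hC Y
    _ = _ := by ring
  · obtain ⟨h1, h2⟩ := Finset.mem_filter.mp hx
    have h1 : x ∈ torsionLE K (n + 1) m := (Set.Finite.mem_toFinset _).mp h1
    exact mem_idealsLE.mpr ⟨h2, (mem_idealsLE.mp h1).2⟩

/-- The number of torsion points of `(K / 𝓞 K) ^ (n + 1)` whose annihilator has norm at most `m`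
is at least of order `m ^ (n + 2)`. Pairs `(I, x)` with `I` in the annihilator of `x` are counted
in two ways. -/
theorem exists_le_ncard_torsionLE (n : ℕ) : ∃ c : ℝ, 0 < c ∧ ∀ᶠ m : ℕ in atTop,
    c * (m : ℝ) ^ (n + 2) ≤ (torsionLE K (n + 1) m).ncard := by
  classical
  obtain ⟨C, hC0, hC⟩ := exists_card_idealsLE_le K
  obtain ⟨c, hc0, hc⟩ := exists_le_sum_absNorm_pow (K := K) (n + 1)
  -- `ε` is so small that the points with annihilator of norm at most `ε * m` carry at most half
  -- of the pairs
  set ε : ℝ := min 1 (c / (2 * C ^ 2)) with hε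
  have hε0 : 0 < ε := by positivity
  have hεC : C ^ 2 * ε ≤ c / 2 := by
    calc C ^ 2 * ε ≤ C ^ 2 * (c / (2 * C ^ 2)) := by gcongr; exact min_le_right _ _
      _ = c / 2 := by field_simp
  refine ⟨c * ε / (2 * C), by positivity, ?_⟩
  filter_upwards [hc, eventually_gt_atTop 0] with m hm hm0
  have hm0' : (0 : ℝ) < m := by exact_mod_cast hm0
  set S := (finite_torsionLE (K := K) (n + 1) m).toFinset
  set D : (Fin (n + 1) → ModIntegers K) → Ideal (𝓞 K) := fun x ↦ Ideal.torsionOf (𝓞 K) _ x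
  set Y := ⌊ε * m⌋₊
  have hYε : (Y : ℝ) ≤ ε * m := Nat.floor_le (by positivity)
  have hYm : Y ≤ m := by
    have : (Y : ℝ) ≤ m := hYε.trans (mul_le_of_le_one_left hm0'.le (min_le_left _ _))
    exact_mod_cast this
  have hD (x) (hx : x ∈ S) : D x ≠ ⊥ :=
    (mem_idealsLE.mp (show x ∈ torsionLE K (n + 1) m from (Set.Finite.mem_toFinset _).mp hx)).2
  have hdouble : ∑ I ∈ idealsLE K m, (Ideal.absNorm I : ℝ) ^ (n + 1) ≤
      ∑ x ∈ S, C * m / Ideal.absNorm (D x) := by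
    have h1 := Finset.sum_card_bipartiteAbove_eq_sum_card_bipartiteBelow
      (fun (I : Ideal (𝓞 K)) x ↦ I ≤ D x) (s := idealsLE K m) (t := S)
    have h2 : ∑ I ∈ idealsLE K m, (Ideal.absNorm I : ℝ) ^ (n + 1) =
        ∑ x ∈ S, (((idealsLE K m).filter (· ≤ D x)).card : ℝ) := by
      have h3 : ∑ I ∈ idealsLE K m, Ideal.absNorm I ^ (n + 1) =
          ∑ x ∈ S, ((idealsLE K m).filter (· ≤ D x)).card := by
        rw [Finset.sum_congr rfl fun I hI ↦ (card_filter_le_torsionOf (n + 1) m hI).symm]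
        exact h1
      exact_mod_cast h3
    rw [h2]
    exact Finset.sum_le_sum fun x hx ↦ card_filter_le hC hC0 m (hD x hx)
  have hsmall : ∑ x ∈ S.filter (fun x ↦ Ideal.absNorm (D x) ≤ Y), C * m / Ideal.absNorm (D x) ≤
      c / 2 * (m : ℝ) ^ (n + 2) := by
    calc _ = C * m * ∑ x ∈ S.filter (fun x ↦ Ideal.absNorm (D x) ≤ Y),
            (1 : ℝ) / Ideal.absNorm (D x) := by
          rw [Finset.mul_sum]
          exact Finset.sum_congr rfl fun x _ ↦ by ring
      _ ≤ C * m * (C * (Y : ℝ) ^ (n + 1)) := by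
          gcongr
          exact sum_torsionLE_div_le hC n m Y hYm
      _ ≤ C * m * (C * (ε * m) ^ (n + 1)) := by gcongr
      _ = C ^ 2 * ε * ε ^ n * (m : ℝ) ^ (n + 2) := by ring
      _ ≤ C ^ 2 * ε * 1 * (m : ℝ) ^ (n + 2) := by
          gcongr
          exact pow_le_one₀ hε0.le (min_le_left _ _)
      _ ≤ _ := by rw [mul_one]; gcongr
  have hlarge : ∑ x ∈ S.filter (fun x ↦ ¬ Ideal.absNorm (D x) ≤ Y), C * m / Ideal.absNorm (D x) ≤
      S.card * (C / ε) := by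
    calc _ ≤ ∑ x ∈ S.filter (fun x ↦ ¬ Ideal.absNorm (D x) ≤ Y), C / ε := by
          refine Finset.sum_le_sum fun x hx ↦ ?_
          obtain ⟨-, hx⟩ := Finset.mem_filter.mp hx
          have : ε * m ≤ Ideal.absNorm (D x) := (Nat.lt_of_floor_lt (not_le.mp hx)).le
          calc C * m / Ideal.absNorm (D x) ≤ C * m / (ε * m) := by gcongr
            _ = C / ε := by field_simp
      _ ≤ _ := by
          rw [Finset.sum_const, nsmul_eq_mul]
          gcongr
          exact Finset.filter_subset _ _
  have hsum := Finset.sum_filter_add_sum_filter_not S (fun x ↦ Ideal.absNorm (D x) ≤ Y)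
    fun x ↦ C * m / Ideal.absNorm (D x)
  have hcardS : (torsionLE K (n + 1) m).ncard = S.card := Set.ncard_eq_toFinset_card _ _
  rw [hcardS]
  have hfinal : c / 2 * (m : ℝ) ^ (n + 2) ≤ S.card * (C / ε) := by linarith
  calc c * ε / (2 * C) * (m : ℝ) ^ (n + 2) = c / 2 * (m : ℝ) ^ (n + 2) * (ε / C) := by field_simp
    _ ≤ S.card * (C / ε) * (ε / C) := by gcongr
    _ = S.card := by field_simp

/-! ### The archimedean part of the height -/

/-- The product over the infinite places `v` of `max_i ‖y_i‖_v` for a tuple of integers `y`. -/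
noncomputable def archHeight {ι : Type*} (y : ι → 𝓞 K) : ℝ :=
  ∏ v : InfinitePlace K, (⨆ i, v (y i : K)) ^ v.mult

lemma mulHeight_mul_absNorm {ι : Type*} [Finite ι] {y : ι → 𝓞 K} (hy : y ≠ 0) :
    Height.mulHeight (fun i ↦ (y i : K)) * Ideal.absNorm (Ideal.span (Set.range y)) =
      archHeight y := by
  have hy' : (fun i ↦ (y i : K)) ≠ 0 := by
    contrapose! hy
    ext i
    simpa using congrFun hy i
  rw [mulHeight_eq hy', mul_assoc, mul_comm (finprod _), absNorm_mul_finprod_finitePlace_eq_one hy,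
    mul_one, archHeight]

lemma mulHeight_le_archHeight {ι : Type*} [Finite ι] {y : ι → 𝓞 K} (hy : y ≠ 0) :
    Height.mulHeight (fun i ↦ (y i : K)) ≤ archHeight y := by
  rw [← mulHeight_mul_absNorm hy]
  refine le_mul_of_one_le_right (Height.mulHeight_pos _).le ?_
  have : Ideal.span (Set.range y) ≠ ⊥ := by
    contrapose! hy
    ext i
    have := Ideal.span_eq_bot.mp hy (y i) ⟨i, rfl⟩
    simp [this]
  exact_mod_cast absNorm_pos this

lemma archHeight_le_of_forall_le {ι : Type*} [Nonempty ι] {y : ι → 𝓞 K}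
    {r : InfinitePlace K → ℝ} (h : ∀ v i, v (y i : K) ≤ r v) :
    archHeight y ≤ ∏ v, r v ^ v.mult := by
  refine Finset.prod_le_prod (fun v _ ↦ ?_) fun v _ ↦ ?_
  · exact pow_nonneg (Real.iSup_nonneg fun _ ↦ apply_nonneg _ _) _
  · exact pow_le_pow_left₀ (Real.iSup_nonneg fun _ ↦ apply_nonneg _ _) (ciSup_le (h v)) _

lemma prod_infinitePlace_eq_absNorm (a : 𝓞 K) :
    ∏ v : InfinitePlace K, v (a : K) ^ v.mult = Ideal.absNorm (Ideal.span {a}) := by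
  rw [InfinitePlace.prod_eq_abs_norm, Ideal.absNorm_span_singleton, ← Algebra.coe_norm_int,
    Nat.cast_natAbs]
  simp

lemma prod_const_pow_mult (R : ℝ) :
    ∏ v : InfinitePlace K, R ^ v.mult = R ^ Module.finrank ℚ K := by
  rw [Finset.prod_pow_eq_pow_sum, InfinitePlace.sum_mult_eq]

/-! ### Many integral points of small height -/

variable (K) in
/-- Every class of `K / 𝓞 K` has a representative all of whose conjugates are bounded by a
constant. -/
lemma exists_bounded_lift : ∃ R : ℕ, 1 ≤ R ∧ ∀ q : ModIntegers K, ∃ x : K,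
    Submodule.Quotient.mk x = q ∧ ∀ v : InfinitePlace K, v x ≤ R := by
  classical
  set b := integralBasis K
  obtain ⟨R, hR⟩ := exists_nat_ge (∑ v : InfinitePlace K, ∑ i, v (b i))
  refine ⟨R + 1, by lia, fun q ↦ ?_⟩
  obtain ⟨x, rfl⟩ := Submodule.Quotient.mk_surjective _ q
  let z : 𝓞 K := ∑ i, ⌊b.repr x i⌋ • RingOfIntegers.basis K i
  have hz : x - (z : K) = ∑ i, (Int.fract (b.repr x i)) • b i := by
    have h1 : (z : K) = ∑ i, (⌊b.repr x i⌋ : ℚ) • b i := by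
      simp [z, b, integralBasis_apply, map_sum, Algebra.smul_def]
    nth_rw 1 [← b.sum_repr x]
    rw [h1, ← Finset.sum_sub_distrib]
    exact Finset.sum_congr rfl fun i _ ↦ by rw [← sub_smul]; rfl
  refine ⟨x - z, ?_, fun v ↦ ?_⟩
  · rw [Submodule.Quotient.mk_sub, sub_eq_self]
    exact mk_modIntegers_eq_zero.mpr ⟨z, rfl⟩
  · calc v (x - z) ≤ ∑ i, v (Int.fract (b.repr x i) • b i) := by
          rw [hz]
          exact v.1.sum_le _ _
      _ ≤ ∑ i, v (b i) := by
          refine Finset.sum_le_sum fun i _ ↦ ?_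
          rw [Algebra.smul_def, map_mul, eq_ratCast, ← InfinitePlace.norm_embedding_eq,
            map_ratCast, Complex.norm_ratCast]
          refine mul_le_of_le_one_left (apply_nonneg _ _) ?_
          rw [abs_of_nonneg (by exact_mod_cast Int.fract_nonneg _)]
          exact_mod_cast (Int.fract_lt_one _).le
      _ ≤ ∑ v : InfinitePlace K, ∑ i, v (b i) :=
          Finset.single_le_sum (f := fun v : InfinitePlace K ↦ ∑ i, v (b i))
            (fun v _ ↦ Finset.sum_nonneg fun _ _ ↦ apply_nonneg _ _) (Finset.mem_univ v)
      _ ≤ (R + 1 : ℕ) := by push_cast; linarith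

variable (K) in
/-- A torsion point `x` of `(K / 𝓞 K)ⁿ` with annihilator of norm at most `m` gives a point
`[1 : x]` of projective space of height at most a constant times `m`. -/
lemma exists_lift_archHeight_le (n : ℕ) : ∃ C : ℕ, 0 < C ∧ ∀ m : ℕ, ∀ x ∈ torsionLE K n m,
    ∃ y : Fin (n + 1) → 𝓞 K, y 0 ≠ 0 ∧ archHeight y ≤ C * m ∧
      ∀ i : Fin n, Submodule.Quotient.mk ((y i.succ : K) / y 0) = x i := by
  obtain ⟨R, hR1, hR⟩ := exists_bounded_lift K
  obtain ⟨C, hC⟩ := exists_mul_eq_span_singleton K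
  refine ⟨(C + 1) * R ^ Module.finrank ℚ K, by positivity, fun m x hx ↦ ?_⟩
  obtain ⟨hx1, hx2⟩ := mem_idealsLE.mp hx
  obtain ⟨J, a, ha, hJ, hIJ, hJC⟩ := hC _ hx2
  have haK : (a : K) ≠ 0 := by simpa using ha
  have hax : a • x = 0 := (Ideal.mem_torsionOf_iff _ _).mp
    ((show _ * J ≤ _ from Ideal.mul_le_left) (hIJ ▸ Ideal.mem_span_singleton_self a))
  choose w hw hwR using fun i ↦ hR (x i)
  have hint (i : Fin n) : ∃ z : 𝓞 K, (z : K) = a * w i := by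
    rw [← smul_mk_modIntegers_eq_zero, hw]
    exact congrFun hax i
  choose z hz using hint
  refine ⟨Fin.cons a z, ha, ?_, fun i ↦ ?_⟩
  · calc archHeight (Fin.cons a z : Fin (n + 1) → 𝓞 K)
        ≤ ∏ v : InfinitePlace K, (v (a : K) * R) ^ v.mult := by
          refine archHeight_le_of_forall_le fun v i ↦ ?_
          refine Fin.cases ?_ (fun i ↦ ?_) i
          · rw [Fin.cons_zero]
            exact le_mul_of_one_le_right (apply_nonneg _ _) (by exact_mod_cast hR1)
          · rw [Fin.cons_succ, hz, map_mul]
            exact mul_le_mul_of_nonneg_left (hwR i v) (apply_nonneg _ _)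
      _ = Ideal.absNorm (Ideal.span {a}) * (R : ℝ) ^ Module.finrank ℚ K := by
          simp_rw [mul_pow, Finset.prod_mul_distrib, prod_infinitePlace_eq_absNorm,
            prod_const_pow_mult]
      _ ≤ (m * (C + 1) : ℕ) * (R : ℝ) ^ Module.finrank ℚ K := by
          gcongr
          rw [← hIJ, map_mul]
          exact Nat.mul_le_mul hx1 (by lia)
      _ = _ := by push_cast; ring
  · rw [Fin.cons_succ, Fin.cons_zero, hz, mul_div_cancel_left₀ _ haK, hw]

variable (K) in
/-- At least of order `B ^ (n + 2)` points of `ℙ ^ (n + 1)` have height at most `B`. The points are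
given by integral representatives with first coordinate nonzero, no two of them proportional. -/
theorem exists_integral_points (n : ℕ) : ∃ c : ℝ, 0 < c ∧ ∀ᶠ B : ℕ in atTop,
    ∃ T : Finset (Fin (n + 2) → 𝓞 K), c * (B : ℝ) ^ (n + 2) ≤ T.card ∧
      (∀ y ∈ T, y 0 ≠ 0 ∧ archHeight y ≤ B) ∧
      ∀ y ∈ T, ∀ y' ∈ T, (∀ i, y i * y' 0 = y' i * y 0) → y = y' := by
  classical
  obtain ⟨c, hc0, hc⟩ := exists_le_ncard_torsionLE (K := K) n
  obtain ⟨C, hC0, hC⟩ := exists_lift_archHeight_le K (n + 1)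
  refine ⟨c / (2 * C) ^ (n + 2), by positivity, ?_⟩
  filter_upwards [(Nat.tendsto_div_const_atTop hC0.ne').eventually hc, eventually_ge_atTop C]
    with B hB hBC
  set m := B / C
  choose! y hy0 hyB hyx using hC m
  have hinj (x) (hx : x ∈ torsionLE K (n + 1) m) (x') (hx' : x' ∈ torsionLE K (n + 1) m)
      (h : ∀ i, y x i * y x' 0 = y x' i * y x 0) : x = x' := by
    ext i
    rw [← hyx x hx i, ← hyx x' hx' i]
    have h0 : (y x 0 : K) ≠ 0 := by simpa using hy0 x hx
    have h0' : (y x' 0 : K) ≠ 0 := by simpa using hy0 x' hx'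
    congr 1
    rw [div_eq_div_iff h0 h0']
    exact_mod_cast h i.succ
  refine ⟨(finite_torsionLE (K := K) (n + 1) m).toFinset.image y, ?_, ?_, ?_⟩
  · rw [Finset.card_image_of_injOn, ← Set.ncard_eq_toFinset_card _ (finite_torsionLE _ _)]
    · refine le_trans ?_ hB
      have h1 : (B : ℝ) ≤ 2 * C * m := by
        have := Nat.lt_mul_div_succ B hC0
        have h2 : C ≤ C * m := Nat.le_mul_of_pos_right _ (Nat.div_pos hBC hC0)
        exact_mod_cast (by simp only [m] at *; nlinarith : B ≤ 2 * C * m)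
      calc c / (2 * C) ^ (n + 2) * (B : ℝ) ^ (n + 2)
          ≤ c / (2 * C) ^ (n + 2) * (2 * C * m) ^ (n + 2) := by gcongr
        _ = c * (m : ℝ) ^ (n + 2) := by rw [mul_pow (2 * C : ℝ)]; field_simp
    · intro x hx x' hx' h
      simp only [Set.Finite.coe_toFinset] at hx hx'
      exact hinj x hx x' hx' fun i ↦ by rw [h]
  · intro z hz
    obtain ⟨x, hx, rfl⟩ := Finset.mem_image.mp hz
    rw [Set.Finite.mem_toFinset] at hx
    refine ⟨hy0 x hx, (hyB x hx).trans ?_⟩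
    exact_mod_cast Nat.mul_div_le B C
  · intro z hz z' hz' h
    obtain ⟨x, hx, rfl⟩ := Finset.mem_image.mp hz
    obtain ⟨x', hx', rfl⟩ := Finset.mem_image.mp hz'
    rw [Set.Finite.mem_toFinset] at hx hx'
    rw [hinj x hx x' hx' h]

/-- A linear subspace of the hypersurface `F = 0` with a parametrisation
`y ↦ (s_j * y_{f j})_j`, where the `s_j` are `0` or `±1`, provides at least of order `B ^ (n + 2)`
points of height at most `B`. -/
theorem exists_le_ncard_boundedHeightPoints {m d n : ℕ} {F : MvPolynomial (Fin m) K}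
    (hF : F.IsHomogeneous d) (hfin : ∀ B : ℕ, (boundedHeightPoints F B).Finite)
    (s : Fin m → ℤ) (hs : ∀ j, |s j| ≤ 1) (f : Fin m → Fin (n + 2)) (g : Fin (n + 2) → Fin m)
    (hfg : ∀ i, f (g i) = i) (hsg : ∀ i, s (g i) = 1)
    (hzero : ∀ y : Fin (n + 2) → K, eval (fun j ↦ (s j : K) * y (f j)) F = 0) :
    ∃ c : ℝ, 0 < c ∧ ∀ᶠ B : ℕ in atTop,
      c * (B : ℝ) ^ (n + 2) ≤ (boundedHeightPoints F B).ncard := by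
  classical
  obtain ⟨c, hc0, hc⟩ := exists_integral_points K n
  refine ⟨c, hc0, ?_⟩
  filter_upwards [hc] with B ⟨T, hcard, hT, hprop⟩
  let φ : (Fin (n + 2) → 𝓞 K) → Fin m → 𝓞 K := fun y j ↦ (s j : 𝓞 K) * y (f j)
  have hφg (y : Fin (n + 2) → 𝓞 K) (i) : φ y (g i) = y i := by simp [φ, hfg, hsg]
  have hne {y : Fin (n + 2) → 𝓞 K} (hy : y ∈ T) : φ y ≠ 0 := fun h ↦ (hT y hy).1 (by
    rw [← hφg y, h]; rfl)
  have hneK {y : Fin (n + 2) → 𝓞 K} (hy : y ∈ T) : (fun j ↦ (φ y j : K)) ≠ 0 := fun h ↦ hne hy (by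
    ext j
    simpa using congrFun h j)
  have hle (y : Fin (n + 2) → 𝓞 K) : archHeight (φ y) ≤ archHeight y := by
    have : Nonempty (Fin m) := ⟨g 0⟩
    refine archHeight_le_of_forall_le fun v j ↦ ?_
    have h1 : v (s j : K) ≤ 1 := by
      rw [← InfinitePlace.norm_embedding_eq, map_intCast, Complex.norm_intCast]
      exact_mod_cast hs j
    calc v (φ y j : K) = v (s j : K) * v (y (f j) : K) := by simp [φ]
      _ ≤ v (y (f j) : K) := mul_le_of_le_one_left (apply_nonneg _ _) h1
      _ ≤ _ := le_ciSup (f := fun i ↦ v (y i : K)) (Set.finite_range _).bddAbove (f j)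
  let P : (Fin (n + 2) → 𝓞 K) → Projectivization K (Fin m → K) := fun y ↦
    if h : y ∈ T then Projectivization.mk K _ (hneK h) else
      Projectivization.mk K (Pi.single (g 0) 1) (by simp)
  have hP {y} (h : y ∈ T) : P y = Projectivization.mk K _ (hneK h) := dif_pos h
  refine hcard.trans ?_
  have hTcard : T.card = (P '' T).ncard := by
    rw [Set.InjOn.ncard_image, Set.ncard_coe_finset]
    intro y hy y' hy' h
    rw [hP hy, hP hy', Projectivization.mk_eq_mk_iff'] at h
    obtain ⟨a, ha⟩ := h
    refine hprop y hy y' hy' fun i ↦ ?_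
    have h1 (i) : a * (y' i : K) = y i := by
      have := congrFun ha (g i)
      simpa only [Pi.smul_apply, smul_eq_mul, hφg] using this
    refine FaithfulSMul.algebraMap_injective (𝓞 K) K ?_
    rw [map_mul, map_mul]
    have h2 := h1 i
    have h3 := h1 0
    rw [show algebraMap (𝓞 K) K (y i) = _ from h2.symm,
      show algebraMap (𝓞 K) K (y 0) = _ from h3.symm]
    ring
  rw [hTcard, Nat.cast_le]
  refine Set.ncard_le_ncard ?_ (hfin B)
  rintro _ ⟨y, hy, rfl⟩
  rw [hP hy]
  refine ⟨(mk_mem_hypersurfacePoints hF _ _).mpr ?_, ?_⟩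
  · have := hzero fun i ↦ (y i : K)
    simpa [φ] using this
  · rw [Projectivization.mulHeight_mk]
    exact (mulHeight_le_archHeight (hne hy)).trans ((hle y).trans (hT y hy).2)

/-! ### Elements of bounded denominator in a box -/

/-- The elements of `a⁻¹ 𝓞 K` with `|x|_v ≤ r v` at all infinite places `v`. -/
def integralBox (a : 𝓞 K) (r : InfinitePlace K → ℝ) : Set K :=
  {x | (∃ z : 𝓞 K, (z : K) = a * x) ∧ ∀ v, v x ≤ r v}

/-- A nonzero element of `a⁻¹ 𝓞 K` has norm at least `1 / |N a|`. -/
lemma one_le_absNorm_mul_prod {a : 𝓞 K} (ha : a ≠ 0) {x : K} (hx : x ≠ 0)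
    (h : ∃ z : 𝓞 K, (z : K) = a * x) :
    1 ≤ Ideal.absNorm (Ideal.span {a}) * ∏ v : InfinitePlace K, v x ^ v.mult := by
  obtain ⟨z, hz⟩ := h
  have hz0 : z ≠ 0 := by
    rintro rfl
    have haK : (a : K) ≠ 0 := by simpa using ha
    simp [hx, haK] at hz
  rw [← prod_infinitePlace_eq_absNorm, ← Finset.prod_mul_distrib]
  simp_rw [← mul_pow, ← map_mul, ← hz, prod_infinitePlace_eq_absNorm]
  exact_mod_cast absNorm_pos (mt Ideal.span_singleton_eq_bot.mp hz0)

/-- The cell containing `x` when the box of radii `r` is cut into pieces of side `r v / M`. -/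
noncomputable def gridCell (M : ℕ) (r : InfinitePlace K → ℝ) (x : K) (v : InfinitePlace K) :
    ℤ × ℤ :=
  (⌊M * (v.embedding x).re / r v⌋, ⌊M * (v.embedding x).im / r v⌋)

lemma floor_mem_Icc {M : ℕ} {r t : ℝ} (hr : 0 < r) (h : |t| ≤ r) :
    ⌊M * t / r⌋ ∈ Finset.Icc (-M : ℤ) M := by
  obtain ⟨h1, h2⟩ := abs_le.mp h
  rw [Finset.mem_Icc, Int.le_floor]
  constructor
  · push_cast
    rw [le_div_iff₀ hr]
    nlinarith [(Nat.cast_nonneg M : (0 : ℝ) ≤ M)]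
  · refine Int.floor_le_iff.mpr ?_
    rw [div_lt_iff₀ hr]
    push_cast
    nlinarith [(Nat.cast_nonneg M : (0 : ℝ) ≤ M)]

lemma abs_sub_le_of_floor_eq {M : ℕ} (hM : 0 < M) {r t t' : ℝ} (hr : 0 < r)
    (h : ⌊M * t / r⌋ = ⌊M * t' / r⌋) : |t - t'| ≤ r / M := by
  have hM' : (0 : ℝ) < M := by exact_mod_cast hM
  have h1 := (Int.abs_sub_lt_one_of_floor_eq_floor h).le
  have h2 : M * t / r - M * t' / r = (t - t') * (M / r) := by ring
  rw [h2, abs_mul, abs_of_pos (by positivity : (0 : ℝ) < M / r)] at h1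
  rw [le_div_iff₀ hM']
  calc |t - t'| * M = |t - t'| * (M / r) * r := by field_simp
    _ ≤ 1 * r := by gcongr
    _ = r := one_mul r

variable (K) in
open Classical in
/-- The possible cells: `2 * M + 1` per real coordinate. -/
noncomputable def gridCells (M : ℕ) : Finset (InfinitePlace K → ℤ × ℤ) :=
  Fintype.piFinset fun v ↦ Finset.Icc (-M : ℤ) M ×ˢ if v.IsReal then {0} else Finset.Icc (-M : ℤ) M

variable (K) in
lemma card_gridCells (M : ℕ) : (gridCells K M).card = (2 * M + 1) ^ Module.finrank ℚ K := by
  classical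
  have h : (Finset.Icc (-M : ℤ) M).card = 2 * M + 1 := by
    rw [Int.card_Icc]
    lia
  rw [gridCells, Fintype.card_piFinset, ← InfinitePlace.sum_mult_eq (K := K),
    ← Finset.prod_pow_eq_pow_sum]
  refine Finset.prod_congr rfl fun v _ ↦ ?_
  rw [Finset.card_product, h, InfinitePlace.mult]
  split_ifs
  · simp
  · rw [h, sq]

lemma gridCell_mem {M : ℕ} {r : InfinitePlace K → ℝ} (hr : ∀ v, 0 < r v) {x : K}
    (hx : ∀ v, v x ≤ r v) : gridCell M r x ∈ gridCells K M := by
  classical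
  refine Fintype.mem_piFinset.mpr fun v ↦ Finset.mem_product.mpr ⟨?_, ?_⟩
  · refine floor_mem_Icc (hr v) ((Complex.abs_re_le_norm _).trans ?_)
    rw [InfinitePlace.norm_embedding_eq]
    exact hx v
  · split_ifs with hv
    · have : (v.embedding x).im = 0 := by
        rw [← Complex.conj_eq_iff_im]
        exact DFunLike.congr_fun (InfinitePlace.isReal_iff.mp hv) x
      simp [gridCell, this]
    · refine floor_mem_Icc (hr v) ((Complex.abs_im_le_norm _).trans ?_)
      rw [InfinitePlace.norm_embedding_eq]
      exact hx v

lemma le_of_gridCell_eq {M : ℕ} (hM : 0 < M) {r : InfinitePlace K → ℝ} (hr : ∀ v, 0 < r v)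
    {x y : K} (h : gridCell M r x = gridCell M r y) (v : InfinitePlace K) :
    v (x - y) ≤ 2 * r v / M := by
  have h1 := congrFun h v
  rw [gridCell, gridCell, Prod.mk.injEq] at h1
  rw [← InfinitePlace.norm_embedding_eq, map_sub]
  calc _ ≤ |(v.embedding x - v.embedding y).re| + |(v.embedding x - v.embedding y).im| :=
        Complex.norm_le_abs_re_add_abs_im _
    _ ≤ r v / M + r v / M := by
        rw [Complex.sub_re, Complex.sub_im]
        exact add_le_add (abs_sub_le_of_floor_eq hM (hr v) h1.1)
          (abs_sub_le_of_floor_eq hM (hr v) h1.2)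
    _ = _ := by ring

/-- A box of radii `r v ≥ 1`, however unbalanced, contains at most of order `|N a| ∏ r v` elements
of `a⁻¹ 𝓞 K`: two of them in the same cell of a fine enough grid would differ by an element of
norm less than `1 / |N a|`. -/
lemma finite_integralBox_and_ncard_le {a : 𝓞 K} (ha : a ≠ 0) {r : InfinitePlace K → ℝ}
    (hr : ∀ v, 1 ≤ r v) :
    (integralBox a r).Finite ∧ ((integralBox a r).ncard : ℝ) ≤ 12 ^ Module.finrank ℚ K *
      (Ideal.absNorm (Ideal.span {a}) * ∏ v : InfinitePlace K, r v ^ v.mult) := by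
  set d := Module.finrank ℚ K
  have hd0 : d ≠ 0 := Module.finrank_pos.ne'
  set X : ℝ := Ideal.absNorm (Ideal.span {a}) * ∏ v : InfinitePlace K, r v ^ v.mult with hX
  have hr0 (v) : 0 < r v := zero_lt_one.trans_le (hr v)
  have hN : 0 < Ideal.absNorm (Ideal.span {a}) :=
    absNorm_pos (mt Ideal.span_singleton_eq_bot.mp ha)
  have hX1 : 1 ≤ X := one_le_mul_of_one_le_of_one_le (by exact_mod_cast hN)
    (Finset.prod_const_one.symm.trans_le
      (Finset.prod_le_prod (fun _ _ ↦ zero_le_one) fun v _ ↦ one_le_pow₀ (hr v)))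
  obtain ⟨t, ht1, htX⟩ : ∃ t : ℝ, 1 ≤ t ∧ t ^ d = X :=
    ⟨X ^ (d⁻¹ : ℝ), Real.one_le_rpow hX1 (by positivity),
      Real.rpow_inv_natCast_pow (by linarith) hd0⟩
  -- cells of side `r v / M` with `M > 2 * t` have diameter less than `r v / t`, and `∏ r v / t ^ d`
  -- is `1 / |N a|`
  set M := ⌊2 * t⌋₊ + 1 with hM
  have hM0 : 0 < M := by lia
  have hM0' : (0 : ℝ) < M := by exact_mod_cast hM0
  have hMt : 2 * t < M := by rw [hM]; push_cast; exact Nat.lt_floor_add_one _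
  have hMt' : (M : ℝ) ≤ 2 * t + 1 := by
    rw [hM]; push_cast; gcongr; exact Nat.floor_le (by linarith)
  have hinj : Set.InjOn (gridCell M r) (integralBox a r) := by
    rintro x ⟨⟨z, hz⟩, -⟩ y ⟨⟨w, hw⟩, -⟩ hxy
    by_contra hne
    have h1 := one_le_absNorm_mul_prod ha (sub_ne_zero.mpr hne)
      ⟨z - w, by rw [mul_sub, ← hz, ← hw]; simp⟩
    refine h1.not_gt ?_
    calc _ ≤ (Ideal.absNorm (Ideal.span {a}) : ℝ) *
          ∏ v : InfinitePlace K, (2 * r v / M) ^ v.mult := by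
          gcongr with v
          exact le_of_gridCell_eq hM0 hr0 hxy v
      _ = X * (2 / M) ^ d := by
          rw [hX, ← prod_const_pow_mult (K := K), mul_assoc, ← Finset.prod_mul_distrib]
          simp_rw [← mul_pow]
          congr 2
          ext v
          ring
      _ = (2 * t / M) ^ d := by rw [← htX]; ring
      _ < 1 := pow_lt_one₀ (by positivity) ((div_lt_one hM0').mpr hMt) hd0
  have hmaps : ∀ x ∈ integralBox a r, gridCell M r x ∈ (gridCells K M : Set _) :=
    fun x hx ↦ gridCell_mem hr0 hx.2
  refine ⟨Set.Finite.of_injOn hmaps hinj (Finset.finite_toSet _), ?_⟩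
  calc ((integralBox a r).ncard : ℝ) ≤ (gridCells K M).card := by
        have := Set.ncard_le_ncard_of_injOn _ hmaps hinj (Finset.finite_toSet _)
        rw [Set.ncard_coe_finset] at this
        exact_mod_cast this
    _ = (2 * M + 1) ^ d := by rw [card_gridCells]; push_cast; rfl
    _ ≤ (12 * t) ^ d := by gcongr; linarith
    _ = 12 ^ d * X := by rw [mul_pow, htX]

/-! ### The number of points of bounded height in projective space -/

variable (K) in
/-- Every point of projective space has an integral representative whose coordinates generate an
ideal of norm at most a constant. -/
lemma exists_integral_representative : ∃ C : ℕ, 0 < C ∧ ∀ (m : ℕ)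
    (p : Projectivization K (Fin m → K)), ∃ (y : Fin m → 𝓞 K) (hy : (fun i ↦ (y i : K)) ≠ 0),
      p = Projectivization.mk K _ hy ∧ archHeight y ≤ C * p.mulHeight := by
  obtain ⟨C, hC⟩ := exists_span_singleton_mul_eq K
  refine ⟨C + 1, by lia, fun m p ↦ ?_⟩
  obtain ⟨s, hs⟩ := IsLocalization.exist_integer_multiples_of_finite (nonZeroDivisors (𝓞 K)) p.rep
  choose w hw using hs
  have hs0 : ((s : 𝓞 K) : K) ≠ 0 := by simp
  have hw' (i) : (w i : K) = (s : 𝓞 K) * p.rep i := by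
    rw [show (w i : K) = _ from hw i, Algebra.smul_def]
  obtain ⟨i₀, hi₀⟩ := Function.ne_iff.mp p.rep_nonzero
  have hI : Ideal.span (Set.range w) ≠ ⊥ := by
    intro h
    have h1 := Ideal.span_eq_bot.mp h (w i₀) ⟨i₀, rfl⟩
    have h2 := hw' i₀
    rw [h1] at h2
    simp [hs0] at h2
    exact hi₀ h2
  obtain ⟨J, a, b, ha, hb, hab, hJ⟩ := hC _ hI
  have haK : (a : K) ≠ 0 := by simpa using ha
  have hbK : (b : K) ≠ 0 := by simpa using hb
  have hdiv (i) : ∃ z, b * z = a * w i := by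
    have : a * w i ∈ Ideal.span {b} * J := hab ▸ Ideal.mul_mem_mul
      (Ideal.mem_span_singleton_self a) (Ideal.subset_span ⟨i, rfl⟩)
    obtain ⟨z, -, hz⟩ := Ideal.mem_span_singleton_mul.mp this
    exact ⟨z, hz⟩
  choose y hy using hdiv
  have hspan : Ideal.span (Set.range y) = J := by
    have h1 : Ideal.span {b} * Ideal.span (Set.range y) =
        Ideal.span {a} * Ideal.span (Set.range w) := by
      rw [Ideal.span_mul_span', Ideal.span_mul_span', Set.singleton_mul, Set.singleton_mul,
        ← Set.range_comp, ← Set.range_comp]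
      congr 2
      ext i
      simp [hy]
    exact mul_left_cancel₀ (mt Ideal.span_singleton_eq_bot.mp hb) (h1.trans hab)
  have hyK : (fun i ↦ (y i : K)) = ((a : K) * (s : 𝓞 K) / b) • p.rep := by
    ext i
    have h1 : (b : K) * y i = a * w i := by exact_mod_cast congrArg (algebraMap (𝓞 K) K) (hy i)
    rw [hw'] at h1
    simp only [Pi.smul_apply, smul_eq_mul]
    field_simp
    linear_combination h1
  have hc : ((a : K) * (s : 𝓞 K) / b) ≠ 0 := by positivity
  have hy0 : (fun i ↦ (y i : K)) ≠ 0 := by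
    rw [hyK]
    exact smul_ne_zero hc p.rep_nonzero
  have hp : p = Projectivization.mk K _ hy0 := by
    conv_lhs => rw [← p.mk_rep]
    rw [Projectivization.mk_eq_mk_iff']
    refine ⟨((a : K) * (s : 𝓞 K) / b)⁻¹, ?_⟩
    rw [hyK, inv_smul_smul₀ hc]
  refine ⟨y, hy0, hp, ?_⟩
  have hy0' : y ≠ 0 := by
    rintro rfl
    exact hy0 (by ext; simp)
  rw [← mulHeight_mul_absNorm hy0', hspan, mul_comm]
  conv_rhs => rw [hp, Projectivization.mulHeight_mk]
  refine mul_le_mul_of_nonneg_right ?_ (Height.mulHeight_pos _).le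
  exact_mod_cast hJ.trans (Nat.le_succ C)

/-- The points `[y]` with `y` integral, `(y i) = I`, and `|y j / y i|_v ≤ 2 ^ (e v + 1)` for all
`j` and all infinite places `v`. -/
def pointCell {m : ℕ} (i : Fin m) (I : Ideal (𝓞 K)) (e : InfinitePlace K → ℕ) :
    Set (Projectivization K (Fin m → K)) :=
  {p | ∃ (y : Fin m → 𝓞 K) (hy : (fun i ↦ (y i : K)) ≠ 0), p = Projectivization.mk K _ hy ∧
    y i ≠ 0 ∧ Ideal.span {y i} = I ∧ ∀ v j, v ((y j : K) / y i) ≤ 2 ^ (e v + 1)}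

lemma finite_pointCell_and_ncard_le {m : ℕ} (i : Fin m) (I : Ideal (𝓞 K))
    (e : InfinitePlace K → ℕ) {A : ℕ}
    (hA : Ideal.absNorm I * ∏ v : InfinitePlace K, (2 ^ e v) ^ v.mult ≤ A) :
    (pointCell i I e).Finite ∧
      ((pointCell i I e).ncard : ℝ) ≤ (24 ^ Module.finrank ℚ K * A) ^ m := by
  classical
  obtain h0 | ⟨-, y₀, -, -, ha, hI, -⟩ := (pointCell i I e).eq_empty_or_nonempty
  · rw [h0]
    simp
    positivity
  set a := y₀ i
  set r : InfinitePlace K → ℝ := fun v ↦ 2 ^ (e v + 1)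
  obtain ⟨hfin, hcard⟩ := finite_integralBox_and_ncard_le ha (r := r)
    fun v ↦ one_le_pow₀ one_le_two
  have hex : ∀ p ∈ pointCell i I e, ∃ x : Fin m → K,
      (∃ hx : x ≠ 0, p = Projectivization.mk K x hx) ∧
      x ∈ (Fintype.piFinset fun _ : Fin m ↦ hfin.toFinset) := by
    rintro p ⟨y, hy, rfl, hyi, hyI, hyv⟩
    have hyiK : (y i : K) ≠ 0 := by simpa using hyi
    refine ⟨(y i : K)⁻¹ • fun j ↦ (y j : K), ⟨smul_ne_zero (inv_ne_zero hyiK) hy, ?_⟩, ?_⟩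
    · rw [Projectivization.mk_eq_mk_iff']
      exact ⟨y i, by rw [smul_inv_smul₀ hyiK]⟩
    · refine Fintype.mem_piFinset.mpr fun j ↦ (Set.Finite.mem_toFinset _).mpr ⟨?_, fun v ↦ ?_⟩
      · have : a ∈ Ideal.span {y i} := hyI ▸ hI ▸ Ideal.mem_span_singleton_self a
        obtain ⟨c, hc⟩ := Ideal.mem_span_singleton'.mp this
        refine ⟨c * y j, ?_⟩
        rw [← hc]
        simp only [Pi.smul_apply, smul_eq_mul]
        push_cast
        field_simp
      · have := hyv v j
        rwa [div_eq_inv_mul] at this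
  choose! x hx hxmem using hex
  have hinj : Set.InjOn x (pointCell i I e) := by
    intro p hp p' hp' h
    obtain ⟨h1, h2⟩ := hx p hp
    obtain ⟨h3, h4⟩ := hx p' hp'
    rw [h2, h4]
    simp only [h]
  refine ⟨Set.Finite.of_injOn hxmem hinj (Finset.finite_toSet _), ?_⟩
  have h1 := Set.ncard_le_ncard_of_injOn x hxmem hinj (Finset.finite_toSet _)
  rw [Set.ncard_coe_finset, Fintype.card_piFinset_const, ← Set.ncard_eq_toFinset_card _ hfin] at h1
  calc ((pointCell i I e).ncard : ℝ) ≤ ((integralBox a r).ncard : ℝ) ^ m := by exact_mod_cast h1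
    _ ≤ (24 ^ Module.finrank ℚ K * A) ^ m := by
        gcongr
        refine hcard.trans ?_
        have h2 : ∏ v : InfinitePlace K, r v ^ v.mult = 2 ^ Module.finrank ℚ K *
            ∏ v : InfinitePlace K, ((2 : ℝ) ^ e v) ^ v.mult := by
          rw [← prod_const_pow_mult (K := K), ← Finset.prod_mul_distrib]
          simp_rw [← mul_pow, r, pow_succ']
        have h3 : (Ideal.absNorm I : ℝ) * ∏ v : InfinitePlace K, ((2 : ℝ) ^ e v) ^ v.mult ≤ A := by
          exact_mod_cast hA
        rw [h2, hI]
        calc _ = 24 ^ Module.finrank ℚ K * ((Ideal.absNorm I : ℝ) *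
              ∏ v : InfinitePlace K, ((2 : ℝ) ^ e v) ^ v.mult) := by
              rw [show (24 : ℝ) = 12 * 2 by norm_num, mul_pow]
              ring
          _ ≤ _ := by gcongr

open Classical in
/-- Every point with a representative of archimedean height at most `A` lies in one of the cells
`pointCell i I e`, where `e` records the quotients `max_j |y j|_v / |y i|_v` up to a factor `2`. -/
lemma exists_mem_pointCell {m : ℕ} {y : Fin m → 𝓞 K} (hy : (fun i ↦ (y i : K)) ≠ 0) {A : ℕ}
    (hA : archHeight y ≤ A) :
    ∃ i, ∃ I ∈ idealsLE K A, ∃ e ∈ Fintype.piFinset fun _ : InfinitePlace K ↦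
      Finset.range (Nat.log 2 A + 1),
      Ideal.absNorm I * ∏ v : InfinitePlace K, (2 ^ e v) ^ v.mult ≤ A ∧
        Projectivization.mk K _ hy ∈ pointCell i I e := by
  obtain ⟨i, hi⟩ := Function.ne_iff.mp hy
  have hi' : y i ≠ 0 := by rintro h; simp [h] at hi
  have hvi (v : InfinitePlace K) : 0 < v (y i : K) := v.pos_iff.mpr hi
  have hle (v : InfinitePlace K) (j) : v (y j : K) ≤ ⨆ j, v (y j : K) :=
    le_ciSup (f := fun j ↦ v (y j : K)) (Set.finite_range _).bddAbove j
  have h1 (v : InfinitePlace K) : 1 ≤ (⨆ j, v (y j : K)) / v (y i : K) :=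
    (one_le_div (hvi v)).mpr (hle v i)
  choose e he he' using fun v ↦ exists_nat_pow_near (h1 v) one_lt_two
  have hI0 : Ideal.span {y i} ≠ ⊥ := mt Ideal.span_singleton_eq_bot.mp hi'
  have hprod : Ideal.absNorm (Ideal.span {y i}) *
      ∏ v : InfinitePlace K, (2 ^ e v) ^ v.mult ≤ A := by
    have h2 : (Ideal.absNorm (Ideal.span {y i}) : ℝ) *
        ∏ v : InfinitePlace K, ((2 : ℝ) ^ e v) ^ v.mult ≤ A := by
      refine le_trans ?_ hA
      rw [← prod_infinitePlace_eq_absNorm, ← Finset.prod_mul_distrib, archHeight]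
      simp_rw [← mul_pow]
      gcongr with v
      rw [mul_comm, ← le_div_iff₀ (hvi v)]
      exact he v
    exact_mod_cast h2
  have hpos : 0 < ∏ v : InfinitePlace K, (2 ^ e v) ^ v.mult :=
    Finset.prod_pos fun v _ ↦ by positivity
  refine ⟨i, Ideal.span {y i}, mem_idealsLE.mpr ⟨?_, hI0⟩, e, Fintype.mem_piFinset.mpr fun v ↦ ?_,
    hprod, y, hy, rfl, hi', rfl, fun v j ↦ ?_⟩
  · exact (Nat.le_mul_of_pos_right _ hpos).trans hprod
  · rw [Finset.mem_range, Nat.lt_succ_iff]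
    have h2 : 2 ^ e v ≤ A := by
      calc 2 ^ e v ≤ (2 ^ e v) ^ v.mult := Nat.le_self_pow v.mult_ne_zero _
        _ ≤ ∏ v : InfinitePlace K, (2 ^ e v) ^ v.mult :=
            Nat.le_of_dvd hpos (Finset.dvd_prod_of_mem
              (fun v : InfinitePlace K ↦ (2 ^ e v) ^ v.mult)
              (Finset.mem_univ v))
        _ ≤ A := (Nat.le_mul_of_pos_left _ (absNorm_pos hI0)).trans hprod
    exact Nat.le_log_of_pow_le one_lt_two h2
  · rw [map_div₀]
    refine le_trans ?_ (he' v).le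
    exact div_le_div_of_nonneg_right (hle v j) (hvi v).le

variable (K) in
/-- There are at most of order `B` ideals `I` and `B ^ o(1)` exponents `e` to consider, and each
cell holds at most of order `B ^ m` points. -/
theorem finite_mulHeight_le_and_exists_ncard_le (m : ℕ) : ∃ (C : ℕ) (D : ℝ), 0 < C ∧ ∀ B : ℕ,
    {p : Projectivization K (Fin m → K) | p.mulHeight ≤ B}.Finite ∧
    ({p : Projectivization K (Fin m → K) | p.mulHeight ≤ B}.ncard : ℝ) ≤
      D * (B : ℝ) ^ (m + 1) * (Nat.log 2 (C * B) + 1) ^ Fintype.card (InfinitePlace K) := by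
  classical
  obtain ⟨C, hC0, hC⟩ := exists_integral_representative K
  obtain ⟨C₁, hC₁0, hC₁⟩ := exists_card_idealsLE_le K
  refine ⟨C, m * (C₁ * C) * (24 ^ Module.finrank ℚ K * C) ^ m, hC0, fun B ↦ ?_⟩
  set A := C * B with hA
  set E := Fintype.piFinset fun _ : InfinitePlace K ↦ Finset.range (Nat.log 2 A + 1)
  set T : Finset (Fin m × Ideal (𝓞 K) × (InfinitePlace K → ℕ)) :=
    (Finset.univ ×ˢ idealsLE K A ×ˢ E).filter fun t ↦
      Ideal.absNorm t.2.1 * ∏ v : InfinitePlace K, (2 ^ t.2.2 v) ^ v.mult ≤ A with hT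
  have hsub : {p : Projectivization K (Fin m → K) | p.mulHeight ≤ B} ⊆
      ⋃ t ∈ T, pointCell t.1 t.2.1 t.2.2 := by
    intro p hp
    obtain ⟨y, hy, rfl, hyA⟩ := hC m p
    have hyA' : archHeight y ≤ A := by
      refine hyA.trans ?_
      rw [hA]
      push_cast
      gcongr
      exact hp
    obtain ⟨i, I, hI, e, he, h1, h2⟩ := exists_mem_pointCell hy hyA'
    refine Set.mem_biUnion (x := (i, I, e)) ?_ h2
    simp only [hT, Finset.coe_filter, Set.mem_ofPred_eq, Finset.mem_product, Finset.mem_univ,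
      true_and]
    exact ⟨⟨hI, he⟩, h1⟩
  have hfin : (⋃ t ∈ T, pointCell t.1 t.2.1 t.2.2).Finite :=
    T.finite_toSet.biUnion fun t ht ↦
      (finite_pointCell_and_ncard_le _ _ _ (Finset.mem_filter.mp ht).2).1
  refine ⟨hfin.subset hsub, ?_⟩
  have hTcard : (T.card : ℝ) ≤
      m * (C₁ * A) * (Nat.log 2 A + 1) ^ Fintype.card (InfinitePlace K) := by
    calc (T.card : ℝ) ≤ (Finset.univ ×ˢ idealsLE K A ×ˢ E : Finset (Fin m × _ × _)).card := by
          exact_mod_cast Finset.card_filter_le _ _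
      _ = m * ((idealsLE K A).card *
            (Nat.log 2 A + 1) ^ Fintype.card (InfinitePlace K)) := by
          rw [Finset.card_product, Finset.card_product,
            show E.card = _ from Fintype.card_piFinset _,
            Finset.prod_const, Finset.card_range, Finset.card_univ, Finset.card_univ,
            Fintype.card_fin]
          push_cast
          rfl
      _ ≤ m * (C₁ * A * (Nat.log 2 A + 1) ^ Fintype.card (InfinitePlace K)) := by
          gcongr
          exact hC₁ A
      _ = _ := by ring
  calc _ ≤ ((⋃ t ∈ T, pointCell t.1 t.2.1 t.2.2).ncard : ℝ) := by
        exact_mod_cast Set.ncard_le_ncard hsub hfin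
    _ ≤ ∑ t ∈ T, ((pointCell t.1 t.2.1 t.2.2).ncard : ℝ) := by
        exact_mod_cast Finset.set_ncard_biUnion_le _ _
    _ ≤ ∑ t ∈ T, (24 ^ Module.finrank ℚ K * A : ℝ) ^ m :=
        Finset.sum_le_sum fun t ht ↦
          (finite_pointCell_and_ncard_le _ _ _ (Finset.mem_filter.mp ht).2).2
    _ = T.card * (24 ^ Module.finrank ℚ K * A : ℝ) ^ m := by rw [Finset.sum_const, nsmul_eq_mul]
    _ ≤ m * (C₁ * A) * (Nat.log 2 A + 1) ^ Fintype.card (InfinitePlace K) *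
          (24 ^ Module.finrank ℚ K * A : ℝ) ^ m := by gcongr
    _ = _ := by
        rw [hA]
        push_cast
        ring

lemma eventually_const_mul_log_pow_le (C s : ℕ) (hC : 0 < C) (D : ℝ) :
    ∀ᶠ B : ℕ in atTop, D * (Nat.log 2 (C * B) + 1 : ℝ) ^ s ≤ B := by
  have ht : Tendsto (fun B : ℕ ↦ ((C * B : ℕ) : ℝ)) atTop atTop :=
    tendsto_natCast_atTop_atTop.comp (tendsto_id.const_mul_atTop' hC)
  set ε : ℝ := 1 / ((|D| + 1) * 3 ^ s * C) with hε
  have hε0 : 0 < ε := by positivity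
  filter_upwards [ht.eventually ((Real.isLittleO_pow_log_id_atTop (n := s)).bound hε0),
    eventually_ge_atTop 3] with B hB hB3
  set x : ℝ := ((C * B : ℕ) : ℝ) with hx
  have hCB : 3 ≤ C * B := hB3.trans (Nat.le_mul_of_pos_left _ hC)
  have hx3 : (3 : ℝ) ≤ x := by rw [hx]; exact_mod_cast hCB
  have hlog1 : 1 ≤ Real.log x := by
    rw [Real.le_log_iff_exp_le (by linarith)]
    exact (Real.exp_one_lt_d9.le.trans (by norm_num)).trans hx3
  have hlog2 : (Nat.log 2 (C * B) : ℝ) ≤ 2 * Real.log x := by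
    have h1 : (2 : ℝ) ^ Nat.log 2 (C * B) ≤ x := by
      rw [hx]
      exact_mod_cast Nat.pow_log_le_self 2 (show C * B ≠ 0 by lia)
    have h2 := Real.log_le_log (by positivity) h1
    rw [Real.log_pow] at h2
    have h3 := Real.log_two_gt_d9
    nlinarith [(Nat.cast_nonneg (Nat.log 2 (C * B)) : (0 : ℝ) ≤ _)]
  have hB' : Real.log x ^ s ≤ ε * x := by
    simp only [id, Real.norm_eq_abs] at hB
    rwa [abs_of_nonneg (by positivity), abs_of_nonneg (by positivity)] at hB
  calc D * (Nat.log 2 (C * B) + 1 : ℝ) ^ s ≤ (|D| + 1) * (3 * Real.log x) ^ s := by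
        gcongr
        · linarith [le_abs_self D]
        · linarith
    _ = (|D| + 1) * 3 ^ s * Real.log x ^ s := by ring
    _ ≤ (|D| + 1) * 3 ^ s * (ε * x) := by gcongr
    _ = B := by rw [hε, hx]; push_cast; field_simp

variable (K) in
/-- A weak form of Schanuel's upper bound, which loses a factor `B ^ 2`. -/
theorem eventually_ncard_mulHeight_le (m : ℕ) : ∀ᶠ B : ℕ in atTop,
    {p : Projectivization K (Fin m → K) | p.mulHeight ≤ B}.ncard ≤ B ^ (m + 2) := by
  obtain ⟨C, D, hC0, h⟩ := finite_mulHeight_le_and_exists_ncard_le K m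
  filter_upwards [eventually_const_mul_log_pow_le C (Fintype.card (InfinitePlace K)) hC0 D]
    with B hB
  have h1 := (h B).2
  have h2 : ({p : Projectivization K (Fin m → K) | p.mulHeight ≤ B}.ncard : ℝ) ≤
      (B : ℝ) ^ (m + 2) := by
    calc _ ≤ _ := h1
      _ = D * (Nat.log 2 (C * B) + 1 : ℝ) ^ Fintype.card (InfinitePlace K) * (B : ℝ) ^ (m + 1) := by
          ring
      _ ≤ B * (B : ℝ) ^ (m + 1) := by gcongr
      _ = _ := by ring
  exact_mod_cast h2

/-! ### The hypersurfaces -/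

lemma finite_boundedHeightPoints {m : ℕ} (F : MvPolynomial (Fin m) K) (B : ℕ) :
    (boundedHeightPoints F B).Finite := by
  obtain ⟨C, D, -, h⟩ := finite_mulHeight_le_and_exists_ncard_le K m
  exact (h B).1.subset fun p hp ↦ hp.2

lemma eventually_ncard_boundedHeightPoints_le {m N : ℕ} (F : MvPolynomial (Fin m) K)
    (hN : m + 2 ≤ N) : ∀ᶠ B : ℕ in atTop, (boundedHeightPoints F B).ncard ≤ B ^ N := by
  obtain ⟨C, D, -, h⟩ := finite_mulHeight_le_and_exists_ncard_le K m
  filter_upwards [eventually_ncard_mulHeight_le K m, eventually_gt_atTop 0] with B hB hB0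
  exact (Set.ncard_le_ncard (fun p hp ↦ hp.2) (h B).1).trans
    (hB.trans (Nat.pow_le_pow_right hB0 hN))

/-- The Fermat cubic contains the linear subspace `x_i + x_{n + 1 + i} = 0`, `i ≤ n`. -/
lemma exists_le_ncard_fermatCubic (n : ℕ) : ∃ c : ℝ, 0 < c ∧ ∀ᶠ B : ℕ in atTop,
    c * (B : ℝ) ^ (n + 2) ≤ (boundedHeightPoints (fermatCubic K (n + 1)) B).ncard := by
  have e : (n + 2) + (n + 2) = 2 * (n + 1) + 2 := by ring
  let φ : Fin (n + 2) ⊕ Fin (n + 2) ≃ Fin (2 * (n + 1) + 2) := finSumFinEquiv.trans (finCongr e)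
  refine exists_le_ncard_boundedHeightPoints (isHomogeneous_fermatCubic K (n + 1))
    (finite_boundedHeightPoints _) (fun j ↦ Sum.elim 1 (-1) (φ.symm j)) (fun j ↦ ?_)
    (fun j ↦ Sum.elim id id (φ.symm j)) (fun i ↦ φ (Sum.inl i)) (fun i ↦ by simp)
    (fun i ↦ by simp) fun y ↦ ?_
  · rcases φ.symm j with i | i <;> simp
  · rw [fermatCubic, map_sum, ← φ.sum_comp, Fintype.sum_sum_type, ← Finset.sum_add_distrib]
    refine Finset.sum_eq_zero fun i _ ↦ ?_
    simp
    ring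

/-- All members of the family contain the Fermat cubic surface `x_4 = x_5 = 0`, and with it the
line `x_0 + x_1 = x_2 + x_3 = 0`. -/
lemma exists_le_ncard_cubicFamily (t : K) : ∃ c : ℝ, 0 < c ∧ ∀ᶠ B : ℕ in atTop,
    c * (B : ℝ) ^ 2 ≤ (boundedHeightPoints (cubicFamily t) B).ncard := by
  refine exists_le_ncard_boundedHeightPoints (n := 0) (isHomogeneous_cubicFamily t)
    (finite_boundedHeightPoints _) ![1, -1, 1, -1, 0, 0] (fun j ↦ by fin_cases j <;> simp)
    ![0, 0, 1, 1, 0, 0] ![0, 2] (fun i ↦ by fin_cases i <;> rfl) (fun i ↦ by fin_cases i <;> rfl)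
    fun y ↦ ?_
  simp [cubicFamily, cubicA, cubicB]
  ring

lemma eventually_rpow_le_const_mul_pow {c r : ℝ} (hc : 0 < c) {N : ℕ} (hr : r < N) :
    ∀ᶠ B : ℕ in atTop, (B : ℝ) ^ r ≤ c * (B : ℝ) ^ N := by
  have h := ((tendsto_rpow_neg_atTop (sub_pos.mpr hr)).comp
    tendsto_natCast_atTop_atTop).eventually_le_const hc
  filter_upwards [h, eventually_gt_atTop 0] with B hB hB0
  have hB0' : (0 : ℝ) < B := by exact_mod_cast hB0
  calc (B : ℝ) ^ r = (B : ℝ) ^ (-((N : ℝ) - r)) * (B : ℝ) ^ N := by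
        rw [← Real.rpow_natCast, ← Real.rpow_add hB0']
        congr 1
        ring
    _ ≤ c * (B : ℝ) ^ N := by gcongr; exact hB

end NumberField

open NumberField

theorem theorem1p4 (k : Type*) [Field k] [NumberField k] :
    -- the Fermat cubics `X^{2n}`
    (∀ n : ℕ, 1 ≤ n →
      (∀ B : ℕ, (boundedHeightPoints (fermatCubic k n) B).Finite) ∧
      ∀ᶠ B : ℕ in atTop,
        (B : ℝ) ^ ((2 * (n : ℝ) + 1) / 4) ≤ ((boundedHeightPoints (fermatCubic k n) B).ncard : ℝ) ∧
        (boundedHeightPoints (fermatCubic k n) B).ncard ≤ B ^ (4 * n + 2)) ∧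
    -- the general member of the family `X_t^4` (the bounds above with `n = 2`)
    (∃ Z : Finset k, ∀ t : k, t ∉ Z →
      (∀ B : ℕ, (boundedHeightPoints (cubicFamily t) B).Finite) ∧
      ∀ᶠ B : ℕ in atTop,
        (B : ℝ) ^ ((5 : ℝ) / 4) ≤ ((boundedHeightPoints (cubicFamily t) B).ncard : ℝ) ∧
        (boundedHeightPoints (cubicFamily t) B).ncard ≤ B ^ 10) ∧
    -- the improved lower bound for the Fermat cubic surface
    (∀ᶠ B : ℕ in atTop, B ≤ (boundedHeightPoints (fermatCubic k 1) B).ncard) := by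
  refine ⟨fun n hn ↦ ⟨finite_boundedHeightPoints _, ?_⟩,
    ⟨∅, fun t _ ↦ ⟨finite_boundedHeightPoints _, ?_⟩⟩, ?_⟩
  · obtain ⟨n, rfl⟩ := Nat.exists_eq_add_of_le' hn
    obtain ⟨c, hc0, hc⟩ := exists_le_ncard_fermatCubic (K := k) n
    have hr : (2 * ((n + 1 : ℕ) : ℝ) + 1) / 4 < (n + 2 : ℕ) := by
      push_cast
      linarith [(Nat.cast_nonneg n : (0 : ℝ) ≤ n)]
    filter_upwards [hc, eventually_rpow_le_const_mul_pow hc0 hr,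
      eventually_ncard_boundedHeightPoints_le (fermatCubic k (n + 1))
        (show 2 * (n + 1) + 2 + 2 ≤ 4 * (n + 1) + 2 by lia)] with B h1 h2 h3
    exact ⟨h2.trans h1, h3⟩
  · obtain ⟨c, hc0, hc⟩ := exists_le_ncard_cubicFamily t
    filter_upwards [hc,
      eventually_rpow_le_const_mul_pow hc0 (show (5 : ℝ) / 4 < (2 : ℕ) by norm_num),
      eventually_ncard_boundedHeightPoints_le (cubicFamily t) (show 6 + 2 ≤ 10 by lia)]
      with B h1 h2 h3
    exact ⟨h2.trans h1, h3⟩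
  · obtain ⟨c, hc0, hc⟩ := exists_le_ncard_fermatCubic (K := k) 0
    filter_upwards [hc, eventually_rpow_le_const_mul_pow hc0 (show (1 : ℝ) < (2 : ℕ) by norm_num)]
      with B h1 h2
    rw [Real.rpow_one] at h2
    exact_mod_cast h2.trans h1
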